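/- Let $\mathcal{X}=\mathbb{C}^n$ and $\mathcal{Y}=\mathbb{C}^m$ with $n,m\ge 1$, and let $\Phi:\mathrm{L}(\mathcal{X})\to\mathrm{L}(\mathcal{Y})$ be an arbitrary super-operator, that is, a linear map from the $n\times n$ to the $m\times m$ complex matrices. Write $\|X\|_1=\operatorname{Tr}\sqrt{X^*X}$ for the trace norm and $\|A\|_\infty$ for the spectral (Euclidean operator) norm of a matrix, and let $$|||\Phi|||_1=\sup_{k\ge 1}\ \sup\{\|(\Phi\otimes 1_{\mathrm{L}(\mathbb{C}^k)})(X)\|_1 : X\in\mathrm{L}(\mathcal{X}\otimes\mathbb{C}^k),\ \|X\|_1\le 1\}$$ be the completely bounded trace norm (diamond norm) of $\Phi$. A Stinespring pair for $\Phi$ is a pair $(A,B)$ of linear operators $A,B:\mathcal{X}\to\mathcal{Y}\otimes\mathcal{Z}$, where $\mathcal{Z}=\mathbb{C}^r$ for some $r\ge 1$, such that $\Phi(X)=\operatorname{Tr}_{\mathcal{Z}}(AXB^*)$ for all $X\in\mathrm{L}(\mathcal{X})$. Then the suprema above are finite, Stinespring pairs for $\Phi$ exist, and $$|||\Phi|||_1=\inf_{(A,B)}\|A\|_\infty\,\|B\|_\infty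 ,$$ where the infimum is over all Stinespring pairs $(A,B)$ for $\Phi$ (with $\mathcal{Z}=\mathbb{C}^r$, $r\ge1$, arbitrary). -/

import Mathlib

open scoped Kronecker

namespace CBNorm

/-- A super-operator from `L(ℂ^ι)` to `L(ℂ^κ)`: a linear map between spaces of square complex
matrices. -/
abbrev SuperOp (ι κ : Type*) : Type _ :=
  Matrix ι ι ℂ →ₗ[ℂ] Matrix κ κ ℂ

section Norms

open scoped Matrix MatrixOrder ComplexOrder

/-- The trace norm `‖A‖₁ = Tr √(A* A)`. The trace is a nonnegative real number. -/
noncomputable def traceNorm {ι κ : Type*} [Fintype ι] [DecidableEq ι] [Fintype κ]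
    (A : Matrix κ ι ℂ) : ℝ :=
  (Matrix.trace (CFC.sqrt (Aᴴ * A))).re

end Norms

section Norms

open scoped Matrix.Norms.L2Operator

/-- The spectral norm `‖A‖_∞`: the operator norm of `A` with respect to the Euclidean norms. -/
noncomputable def opNorm {ι κ : Type*} [Fintype ι] [DecidableEq ι] [Fintype κ]
    (A : Matrix κ ι ℂ) : ℝ :=
  ‖A‖

end Norms

/-- The super-operator `Φ ⊗ 𝟙_{L(ℂ^τ)}`: apply `Φ` to each of the blocks of the matrix that are
indexed by `τ × τ`. -/
def tensorId {ι κ : Type*} (τ : Type*) (Φ : SuperOp ι κ) : SuperOp (ι × τ) (κ × τ) where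
  toFun X := Matrix.of fun p q => Φ (Matrix.of fun i j => X (i, p.2) (j, q.2)) p.1 q.1
  map_add' X Y := by
    ext p q
    exact congrFun (congrFun (map_add Φ (Matrix.of fun i j => X (i, p.2) (j, q.2))
      (Matrix.of fun i j => Y (i, p.2) (j, q.2))) p.1) q.1
  map_smul' c X := by
    ext p q
    exact congrFun (congrFun (map_smul Φ c (Matrix.of fun i j => X (i, p.2) (j, q.2))) p.1) q.1

/-- `Φ ⊗ 𝟙` acts on elementary tensors as it should; this determines it, by linearity. -/
theorem tensorId_kronecker {ι κ τ : Type*} (Φ : SuperOp ι κ) (X : Matrix ι ι ℂ)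
    (W : Matrix τ τ ℂ) : tensorId τ Φ (X ⊗ₖ W) = Φ X ⊗ₖ W := by
  ext p q
  have h : (Matrix.of fun i j => (X ⊗ₖ W) (i, p.2) (j, q.2)) = W p.2 q.2 • X := by
    ext i j
    simp [mul_comm]
  change Φ (Matrix.of fun i j => (X ⊗ₖ W) (i, p.2) (j, q.2)) p.1 q.1 = _
  rw [h, map_smul]
  simp [mul_comm]

/-- The set of values `‖Φ(X)‖₁` with `‖X‖₁ ≤ 1`. -/
def traceNormValues {ι κ : Type*} [Fintype ι] [DecidableEq ι] [Fintype κ] [DecidableEq κ]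
    (Φ : SuperOp ι κ) : Set ℝ :=
  {t | ∃ X : Matrix ι ι ℂ, traceNorm X ≤ 1 ∧ t = traceNorm (Φ X)}

/-- The induced super-operator norm `‖Φ‖₁`. -/
noncomputable def inducedTraceNorm {ι κ : Type*} [Fintype ι] [DecidableEq ι] [Fintype κ]
    [DecidableEq κ] (Φ : SuperOp ι κ) : ℝ :=
  sSup (traceNormValues Φ)

/-- The set of values `‖Φ ⊗ 𝟙_{L(ℂ^k)}‖₁` with `k ≥ 1`. -/
def ampliationNorms {ι κ : Type*} [Fintype ι] [DecidableEq ι] [Fintype κ]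
    [DecidableEq κ] (Φ : SuperOp ι κ) : Set ℝ :=
  {t | ∃ k : ℕ, 1 ≤ k ∧ t = inducedTraceNorm (tensorId (Fin k) Φ)}

/-- The completely bounded trace norm (diamond norm) `|||Φ|||₁`. -/
noncomputable def cbTraceNorm {ι κ : Type*} [Fintype ι] [DecidableEq ι] [Fintype κ]
    [DecidableEq κ] (Φ : SuperOp ι κ) : ℝ :=
  sSup (ampliationNorms Φ)

/-- The partial trace `Tr_𝒵 : L(𝒴 ⊗ 𝒵) → L(𝒴)` over the second tensor factor. -/
def partialTrace {κ ζ : Type*} [Fintype ζ] (M : Matrix (κ × ζ) (κ × ζ) ℂ) : Matrix κ κ ℂ :=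
  Matrix.of fun i j => ∑ z, M (i, z) (j, z)

open scoped Matrix in
/-- `(A, B)` is a Stinespring pair for `Φ`: `Φ(X) = Tr_𝒵 (A X B*)` for all `X`. -/
def IsStinespringPair {ι κ ζ : Type*} [Fintype ι] [Fintype ζ] (Φ : SuperOp ι κ)
    (A B : Matrix (κ × ζ) ι ℂ) : Prop :=
  ∀ X : Matrix ι ι ℂ, Φ X = partialTrace (A * X * Bᴴ)

/-- The set of values `‖A‖_∞ ‖B‖_∞` over all Stinespring pairs `(A, B)` for `Φ`, where the
auxiliary space `𝒵 = ℂ^r`, `r ≥ 1`, is arbitrary. -/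
def stinespringNormProducts {ι κ : Type*} [Fintype ι] [DecidableEq ι] [Fintype κ]
    (Φ : SuperOp ι κ) : Set ℝ :=
  {t | ∃ r : ℕ, 1 ≤ r ∧ ∃ A B : Matrix (κ × Fin r) ι ℂ,
    IsStinespringPair Φ A B ∧ t = opNorm A * opNorm B}

end CBNorm

/-! Upper bound: factor `X = V * Wᴴ` with both Frobenius norms squared equal to `traceNorm X` (polar
decomposition). A Stinespring pair turns this into a factorization of the ampliated image with
factors `ampliate A V` and `ampliate B W`; Cauchy–Schwarz then bounds its trace norm by `opNorm A *
opNorm B * traceNorm X`, uniformly in the ampliation.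

Lower bound: let `C` be the diamond norm. For invertible `R`, `S`, splitting the image of `vec(R)
vec(S)*` under the ampliation with `k = n` gives a Stinespring pair for which `A * R` and `B * S`
are small on average in Frobenius norm (`exists_isStinespringPair_of_isUnit`). The order of
quantifiers must be reversed: one pair has to serve all weights. The Gram pairs `(Aᴴ * A, Bᴴ * B)`
form a convex set (`convex_stinespringGrams`). If it missed the ball of radius `C + ε`, Hahn–Banach
would give a separating functional, dominated on positive semidefinite matrices by weights `R * Rᴴ`,
`S * Sᴴ`; the pair adapted to these weights contradicts the separation. -/

namespace CBNorm

/-! ### Frobenius norm and Cauchy–Schwarz. -/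

section Frobenius

open scoped Matrix

variable {ι κ ζ : Type*} [Fintype ι] [Fintype κ] [Fintype ζ]

/-- The square of the Frobenius norm of a matrix. -/
noncomputable def frobSq (A : Matrix κ ι ℂ) : ℝ :=
  ∑ i, ∑ j, ‖A i j‖ ^ 2

theorem frobSq_nonneg (A : Matrix κ ι ℂ) : 0 ≤ frobSq A := by
  unfold frobSq; positivity

theorem trace_conjTranspose_mul_self (A : Matrix κ ι ℂ) :
    Matrix.trace (Aᴴ * A) = (frobSq A : ℂ) := by
  simp only [Matrix.trace, Matrix.diag, Matrix.mul_apply, Matrix.conjTranspose_apply, frobSq]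
  rw [Finset.sum_comm]
  push_cast
  refine Finset.sum_congr rfl fun i _ => Finset.sum_congr rfl fun j _ => ?_
  exact Complex.conj_mul' _

theorem frobSq_smul (c : ℂ) (A : Matrix κ ι ℂ) : frobSq (c • A) = ‖c‖ ^ 2 * frobSq A := by
  simp [frobSq, mul_pow, Finset.mul_sum]

/-- The Cauchy–Schwarz inequality for the Hilbert–Schmidt inner product. -/
theorem norm_trace_mul_conjTranspose_le (V W : Matrix κ ι ℂ) :
    ‖Matrix.trace (V * Wᴴ)‖ ≤ √(frobSq V) * √(frobSq W) := by
  have h1 : ‖Matrix.trace (V * Wᴴ)‖ ≤ ∑ p : κ × ι, ‖V p.1 p.2‖ * ‖W p.1 p.2‖ := by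
    rw [Fintype.sum_prod_type]
    simp only [Matrix.trace, Matrix.diag, Matrix.mul_apply, Matrix.conjTranspose_apply]
    refine (norm_sum_le _ _).trans (Finset.sum_le_sum fun i _ => ?_)
    refine (norm_sum_le _ _).trans (Finset.sum_le_sum fun j _ => ?_)
    simp
  refine h1.trans ?_
  have h2 := Real.sum_mul_le_sqrt_mul_sqrt Finset.univ (fun p : κ × ι => ‖V p.1 p.2‖)
    (fun p => ‖W p.1 p.2‖)
  simpa only [frobSq, Fintype.sum_prod_type] using h2

theorem frobSq_mul_le [DecidableEq ι] (A : Matrix κ ι ℂ) (V : Matrix ι ζ ℂ) :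
    frobSq (A * V) ≤ opNorm A ^ 2 * frobSq V := by
  have key : ∀ j, ∑ i, ‖(A * V) i j‖ ^ 2 ≤ opNorm A ^ 2 * ∑ i, ‖V i j‖ ^ 2 := by
    intro j
    have h := Matrix.l2_opNorm_mulVec A (WithLp.toLp 2 fun i => V i j)
    have h' := pow_le_pow_left₀ (norm_nonneg _) h 2
    rw [mul_pow, EuclideanSpace.norm_sq_eq, EuclideanSpace.norm_sq_eq] at h'
    simpa [opNorm, Matrix.mul_apply, Matrix.mulVec, dotProduct] using h'
  have e1 : frobSq (A * V) = ∑ j, ∑ i, ‖(A * V) i j‖ ^ 2 := Finset.sum_comm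
  have e2 : frobSq V = ∑ j, ∑ i, ‖V i j‖ ^ 2 := Finset.sum_comm
  rw [e1, e2, Finset.mul_sum]
  exact Finset.sum_le_sum fun j _ => key j

end Frobenius

/-! ### Spectral norm. -/

section OpNorm

open scoped Matrix Matrix.Norms.L2Operator

variable {ι κ : Type*} [Fintype ι] [Fintype κ] [DecidableEq ι]

theorem opNorm_nonneg (A : Matrix κ ι ℂ) : 0 ≤ opNorm A := norm_nonneg A

theorem opNorm_conjTranspose [DecidableEq κ] (A : Matrix κ ι ℂ) : opNorm Aᴴ = opNorm A :=
  Matrix.l2_opNorm_conjTranspose A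

/-- A partial isometry is a contraction. -/
theorem opNorm_le_one_of_isIdempotentElem {U : Matrix κ ι ℂ} (h : IsIdempotentElem (Uᴴ * U)) :
    opNorm U ≤ 1 := by
  -- The C*-identity, used for `Uᴴ * U` and for `U`, gives `‖U‖ ^ 4 = ‖U‖ ^ 2`.
  have h1 := Matrix.l2_opNorm_conjTranspose_mul_self (Uᴴ * U)
  rw [Matrix.conjTranspose_mul, Matrix.conjTranspose_conjTranspose, h.eq,
    Matrix.l2_opNorm_conjTranspose_mul_self] at h1
  change ‖U‖ ≤ 1
  by_contra! hU
  nlinarith [mul_pos (zero_lt_one.trans hU) (zero_lt_one.trans hU),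
    one_lt_mul_of_lt_of_le hU hU.le]

end OpNorm

/-! ### Polar decomposition and trace norm. -/

section TraceNorm

open scoped Matrix MatrixOrder ComplexOrder

variable {ι κ ζ : Type*} [Fintype ι] [DecidableEq ι] [Fintype κ] [Fintype ζ]

/-- Polar decomposition `X = U |X|`, with `|X| = W W*`. -/
theorem exists_polar (X : Matrix κ ι ℂ) : ∃ (U : Matrix κ ι ℂ) (W : Matrix ι ι ℂ),
    IsIdempotentElem (Uᴴ * U) ∧ U * W * Wᴴ = X ∧ Uᴴ * X = CFC.sqrt (Xᴴ * X) ∧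
      Wᴴ * W = CFC.sqrt (Xᴴ * X) ∧ (U * W)ᴴ * (U * W) = CFC.sqrt (Xᴴ * X) := by
  set H := Xᴴ * X with hH
  have hpos : 0 ≤ H := Matrix.nonneg_iff_posSemidef.2 (Matrix.posSemidef_conjTranspose_mul_self X)
  have hsa : IsSelfAdjoint H := IsSelfAdjoint.of_nonneg hpos
  have hc : ∀ f : ℝ → ℝ, ContinuousOn f (spectrum ℝ H) := fun f =>
    Matrix.finite_real_spectrum.continuousOn f
  have hmul : ∀ f g : ℝ → ℝ, cfc f H * cfc g H = cfc (fun x => f x * g x) H := fun f g =>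
    (cfc_mul f g H (hc f) (hc g)).symm
  have hstar : ∀ f : ℝ → ℝ, (cfc f H)ᴴ = cfc f H := fun f =>
    (cfc_predicate f H : IsSelfAdjoint (cfc f H))
  have hid : cfc (fun x : ℝ => x) H = H := cfc_id' ℝ H
  have hsqrt : CFC.sqrt H = cfc Real.sqrt H := by
    rw [CFC.sqrt_eq_real_sqrt H hpos, cfcₙ_eq_cfc Real.continuous_sqrt.continuousOn]
  have hcongr : ∀ f g : ℝ → ℝ, (∀ x, 0 ≤ x → f x = g x) → cfc f H = cfc g H := fun f g h =>
    cfc_congr fun x hx => h x (spectrum_nonneg_of_nonneg hpos hx)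
  have hXX : ∀ f g : ℝ → ℝ, (X * cfc f H)ᴴ * (X * cfc g H) = cfc (fun x => f x * (x * g x)) H := by
    intro f g
    rw [Matrix.conjTranspose_mul, hstar, Matrix.mul_assoc, ← Matrix.mul_assoc Xᴴ, ← hH]
    nth_rewrite 2 [← hid]
    rw [hmul, hmul]
  -- As `0⁻¹ = 0`, this function of `H` is the projection onto the range of `H`; `X` vanishes on the
  -- kernel of `H`.
  have hX0 : X * cfc (fun x : ℝ => (√x)⁻¹ * √x) H = X := by
    have h1 : X * cfc (fun x : ℝ => 1 - (√x)⁻¹ * √x) H = 0 := by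
      rw [← Matrix.conjTranspose_mul_self_eq_zero, hXX, ← cfc_zero ℝ H]
      refine hcongr _ _ fun x hx => ?_
      rcases hx.eq_or_lt with rfl | hx
      · simp
      · have : √x ≠ 0 := (Real.sqrt_pos.2 hx).ne'
        simp [this]
    rw [cfc_sub (fun _ => (1 : ℝ)) _ H (hc _) (hc _), cfc_const_one ℝ H, Matrix.mul_sub,
      Matrix.mul_one, sub_eq_zero] at h1
    exact h1.symm
  -- `U` is `X` times the pseudo-inverse of `|X|`, and `W = |X|^(1/2)`.
  refine ⟨X * cfc (fun x : ℝ => (√x)⁻¹) H, cfc (fun x : ℝ => √√x) H, ?_, ?_, ?_, ?_, ?_⟩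
  · rw [IsIdempotentElem, hXX, hmul]
    refine hcongr _ _ fun x hx => ?_
    rcases hx.eq_or_lt with rfl | hx
    · simp
    · have : √x ≠ 0 := (Real.sqrt_pos.2 hx).ne'
      have h2 := Real.mul_self_sqrt hx.le
      have : (√x)⁻¹ * (x * (√x)⁻¹) = 1 := by
        nth_rewrite 2 [← h2]
        field_simp
      simp [this]
  · rw [hstar, Matrix.mul_assoc, Matrix.mul_assoc, hmul, hmul]
    nth_rewrite 2 [← hX0]
    congr 1
    refine hcongr _ _ fun x hx => ?_
    rw [Real.mul_self_sqrt (Real.sqrt_nonneg x)]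
  · have := hXX (fun x => (√x)⁻¹) (fun _ => 1)
    rw [cfc_const_one ℝ H, Matrix.mul_one] at this
    rw [this, hsqrt]
    refine hcongr _ _ fun x hx => ?_
    rcases hx.eq_or_lt with rfl | hx
    · simp
    · have : √x ≠ 0 := (Real.sqrt_pos.2 hx).ne'
      have h2 := Real.mul_self_sqrt hx.le
      rw [inv_mul_eq_iff_eq_mul₀ this, h2, mul_one]
  · rw [hstar, hmul, hsqrt]
    exact hcongr _ _ fun x hx => Real.mul_self_sqrt (Real.sqrt_nonneg x)
  · rw [Matrix.mul_assoc, hmul, hXX, hsqrt]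
    refine hcongr _ _ fun x hx => ?_
    rcases hx.eq_or_lt with rfl | hx
    · simp
    · have h1 : √x ≠ 0 := (Real.sqrt_pos.2 hx).ne'
      have h2 := Real.mul_self_sqrt hx.le
      have h3 := Real.mul_self_sqrt (Real.sqrt_nonneg x)
      calc (√x)⁻¹ * √√x * (x * ((√x)⁻¹ * √√x)) = (√x)⁻¹ * (√x)⁻¹ * (√√x * √√x) * x := by ring
        _ = (√x)⁻¹ * (√x)⁻¹ * √x * (√x * √x) := by rw [h2, h3]
        _ = √x := by field_simp

/-- Every matrix is a product of two factors whose Frobenius norms are controlled by its trace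
norm. -/
theorem exists_mul_conjTranspose_eq (X : Matrix κ ι ℂ) :
    ∃ (V : Matrix κ ι ℂ) (W : Matrix ι ι ℂ), V * Wᴴ = X ∧
      frobSq V = traceNorm X ∧ frobSq W = traceNorm X := by
  obtain ⟨U, W, -, h1, -, h2, h3⟩ := exists_polar X
  refine ⟨U * W, W, h1, ?_, ?_⟩
  · rw [traceNorm, ← h3, trace_conjTranspose_mul_self, Complex.ofReal_re]
  · rw [traceNorm, ← h2, trace_conjTranspose_mul_self, Complex.ofReal_re]

theorem traceNorm_nonneg (X : Matrix κ ι ℂ) : 0 ≤ traceNorm X := by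
  obtain ⟨V, W, -, h, -⟩ := exists_mul_conjTranspose_eq X
  exact h ▸ frobSq_nonneg V

/-- The trace norm is attained by pairing with a contraction. -/
theorem exists_trace_eq_traceNorm (X : Matrix κ ι ℂ) :
    ∃ U : Matrix κ ι ℂ, opNorm U ≤ 1 ∧ (Matrix.trace (Uᴴ * X)).re = traceNorm X := by
  obtain ⟨U, W, h0, -, h1, -⟩ := exists_polar X
  exact ⟨U, opNorm_le_one_of_isIdempotentElem h0, by rw [h1, traceNorm]⟩

/-- The contraction attaining the trace norm is absorbed into `V`; Cauchy–Schwarz does the rest. -/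
theorem traceNorm_mul_conjTranspose_le [DecidableEq κ] (V : Matrix κ ζ ℂ) (W : Matrix ι ζ ℂ) :
    traceNorm (V * Wᴴ) ≤ √(frobSq V) * √(frobSq W) := by
  obtain ⟨U, hU, h⟩ := exists_trace_eq_traceNorm (V * Wᴴ)
  rw [← h, ← Matrix.mul_assoc]
  refine (Complex.re_le_norm _).trans ((norm_trace_mul_conjTranspose_le _ _).trans ?_)
  gcongr
  refine (frobSq_mul_le Uᴴ V).trans ?_
  rw [opNorm_conjTranspose]
  exact mul_le_of_le_one_left (frobSq_nonneg V) (pow_le_one₀ (opNorm_nonneg U) hU)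

theorem traceNorm_smul_le [DecidableEq κ] (c : ℂ) (X : Matrix κ ι ℂ) :
    traceNorm (c • X) ≤ ‖c‖ * traceNorm X := by
  obtain ⟨V, W, h, hV, hW⟩ := exists_mul_conjTranspose_eq X
  have := traceNorm_mul_conjTranspose_le (c • V) W
  rw [Matrix.smul_mul, h, frobSq_smul, hV, hW, Real.sqrt_mul (by positivity),
    Real.sqrt_sq (norm_nonneg c), mul_assoc, Real.mul_self_sqrt (traceNorm_nonneg X)] at this
  exact this

end TraceNorm

/-! ### Stinespring pairs and factorizations of ampliated images. -/

section Stinespring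

open scoped Matrix

variable {ι κ τ ζ ξ : Type*} [Fintype ι] [Fintype ζ] [Fintype ξ]

/-- The operator `(A ⊗ 𝟙) V`, with the auxiliary tensor factor of the codomain of `A` moved to
the domain. -/
def ampliate (A : Matrix (κ × ζ) ι ℂ) (V : Matrix (ι × τ) ξ ℂ) : Matrix (κ × τ) (ζ × ξ) ℂ :=
  Matrix.of fun p q => (A * Matrix.of fun i c => V (i, p.2) c) (p.1, q.1) q.2

theorem frobSq_ampliate_le [Fintype κ] [Fintype τ] [DecidableEq ι]
    (A : Matrix (κ × ζ) ι ℂ) (V : Matrix (ι × τ) ξ ℂ) :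
    frobSq (ampliate A V) ≤ opNorm A ^ 2 * frobSq V := by
  have e1 : frobSq (ampliate A V) = ∑ a, frobSq (A * Matrix.of fun i c => V (i, a) c) := by
    simp only [frobSq, ampliate, Fintype.sum_prod_type, Matrix.of_apply]
    rw [Finset.sum_comm]
  have e2 : frobSq V = ∑ a, frobSq (Matrix.of fun i c => V (i, a) c) := by
    simp only [frobSq, Fintype.sum_prod_type, Matrix.of_apply]
    rw [Finset.sum_comm]
  rw [e1, e2, Finset.mul_sum]
  exact Finset.sum_le_sum fun a _ => frobSq_mul_le _ _

/-- The traced-out index `ζ` becomes part of the summation index of a matrix product. -/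
theorem IsStinespringPair.tensorId_mul_conjTranspose {Φ : SuperOp ι κ} {A B : Matrix (κ × ζ) ι ℂ}
    (h : IsStinespringPair Φ A B) (V W : Matrix (ι × τ) ξ ℂ) :
    tensorId τ Φ (V * Wᴴ) = ampliate A V * (ampliate B W)ᴴ := by
  ext p q
  have e : (Matrix.of fun i j => (V * Wᴴ) (i, p.2) (j, q.2)) =
      (Matrix.of fun i c => V (i, p.2) c) * (Matrix.of fun i c => W (i, q.2) c)ᴴ := by
    ext i j
    simp [Matrix.mul_apply]
  change Φ (Matrix.of fun i j => (V * Wᴴ) (i, p.2) (j, q.2)) p.1 q.1 = _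
  rw [e, h, ← Matrix.mul_assoc, Matrix.mul_assoc, ← Matrix.conjTranspose_mul]
  simp only [partialTrace, Matrix.of_apply]
  rw [Matrix.mul_apply, Fintype.sum_prod_type]
  refine Finset.sum_congr rfl fun z _ => ?_
  rw [Matrix.mul_apply]
  rfl

theorem IsStinespringPair.traceNorm_tensorId_le [Fintype κ] [Fintype τ]
    [DecidableEq ι] [DecidableEq κ] [DecidableEq τ] {Φ : SuperOp ι κ}
    {A B : Matrix (κ × ζ) ι ℂ} (h : IsStinespringPair Φ A B) (X : Matrix (ι × τ) (ι × τ) ℂ) :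
    traceNorm (tensorId τ Φ X) ≤ opNorm A * opNorm B * traceNorm X := by
  obtain ⟨V, W, hX, hV, hW⟩ := exists_mul_conjTranspose_eq X
  rw [← hX, h.tensorId_mul_conjTranspose, hX]
  have hs : ∀ (A : Matrix (κ × ζ) ι ℂ) (V : Matrix (ι × τ) (ι × τ) ℂ), frobSq V = traceNorm X →
      √(frobSq (ampliate A V)) ≤ opNorm A * √(traceNorm X) := by
    intro A V hV
    refine (Real.sqrt_le_sqrt (frobSq_ampliate_le A V)).trans_eq ?_
    rw [Real.sqrt_mul (by positivity), Real.sqrt_sq (opNorm_nonneg A), hV]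
  calc _ ≤ _ := traceNorm_mul_conjTranspose_le _ _
    _ ≤ (opNorm A * √(traceNorm X)) * (opNorm B * √(traceNorm X)) :=
        mul_le_mul (hs A V hV) (hs B W hW) (Real.sqrt_nonneg _)
          (mul_nonneg (opNorm_nonneg A) (Real.sqrt_nonneg _))
    _ = opNorm A * opNorm B * (√(traceNorm X) * √(traceNorm X)) := by ring
    _ = _ := by rw [Real.mul_self_sqrt (traceNorm_nonneg X)]

/-- The rank-one operator `vec(R) vec(S)*`. -/
def vecOuter (R S : Matrix ι τ ℂ) : Matrix (ι × τ) (ι × τ) ℂ :=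
  Matrix.of fun p q => R p.1 p.2 * star (S q.1 q.2)

theorem traceNorm_vecOuter_le [Fintype τ] [DecidableEq ι] [DecidableEq τ] (R S : Matrix ι τ ℂ) :
    traceNorm (vecOuter R S) ≤ √(frobSq R) * √(frobSq S) := by
  have h := traceNorm_mul_conjTranspose_le
    (Matrix.of fun (p : ι × τ) (_ : Unit) => R p.1 p.2)
    (Matrix.of fun (p : ι × τ) (_ : Unit) => S p.1 p.2)
  have e : (Matrix.of fun (p : ι × τ) (_ : Unit) => R p.1 p.2) *
      (Matrix.of fun (p : ι × τ) (_ : Unit) => S p.1 p.2)ᴴ = vecOuter R S := by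
    ext p q
    simp [Matrix.mul_apply, vecOuter]
  rw [e] at h
  simpa [frobSq, Fintype.sum_prod_type] using h

/-- A factorization of `(Φ ⊗ 𝟙)(vec(R) vec(S)*)`, with `R` and `S` invertible, yields a
Stinespring pair. -/
theorem isStinespringPair_of_factorization [DecidableEq ι] (Φ : SuperOp ι κ) {R S : Matrix ι ι ℂ}
    (hR : IsUnit R.det) (hS : IsUnit S.det) (V W : Matrix (κ × ι) ζ ℂ)
    (h : tensorId ι Φ (vecOuter R S) = V * Wᴴ) :
    IsStinespringPair Φ ((Matrix.of fun (p : κ × ζ) a => V (p.1, a) p.2) * R⁻¹)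
      ((Matrix.of fun (p : κ × ζ) a => W (p.1, a) p.2) * S⁻¹) := by
  intro X
  set Y := R⁻¹ * X * (S⁻¹)ᴴ with hY
  -- Invertibility makes the products of a column of `R` with an adjoint column of `S` span all
  -- matrices; `h` prescribes `Φ` on exactly these.
  have hX : X = ∑ a, ∑ b, Y a b • Matrix.of fun i j => R i a * star (S j b) := by
    have h1 : X = R * Y * Sᴴ := by
      have h2 : (S⁻¹)ᴴ * Sᴴ = 1 := by
        rw [← Matrix.conjTranspose_mul, Matrix.mul_nonsing_inv S hS, Matrix.conjTranspose_one]
      rw [hY, ← Matrix.mul_assoc, ← Matrix.mul_assoc, Matrix.mul_nonsing_inv R hR, Matrix.one_mul,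
        Matrix.mul_assoc, h2, Matrix.mul_one]
    nth_rewrite 1 [h1]
    ext i j
    simp only [Matrix.mul_apply, Matrix.sum_apply, Matrix.smul_apply, Matrix.of_apply,
      Matrix.conjTranspose_apply, Finset.sum_mul, smul_eq_mul]
    rw [Finset.sum_comm]
    refine Finset.sum_congr rfl fun a _ => Finset.sum_congr rfl fun b _ => by ring
  have hΦ : ∀ a b p q, Φ (Matrix.of fun i j => R i a * star (S j b)) p q =
      ∑ z, V (p, a) z * star (W (q, b) z) := fun a b p q => by
    have := congrFun (congrFun h (p, a)) (q, b)
    rw [Matrix.mul_apply] at this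
    exact this
  have e : (Matrix.of fun (p : κ × ζ) a => V (p.1, a) p.2) * R⁻¹ * X *
      ((Matrix.of fun (p : κ × ζ) a => W (p.1, a) p.2) * S⁻¹)ᴴ =
      (Matrix.of fun (p : κ × ζ) a => V (p.1, a) p.2) * Y *
        (Matrix.of fun (p : κ × ζ) a => W (p.1, a) p.2)ᴴ := by
    rw [hY, Matrix.conjTranspose_mul]
    simp only [Matrix.mul_assoc]
  rw [e]
  nth_rewrite 1 [hX]
  ext p q
  simp only [map_sum, map_smul, Matrix.sum_apply, Matrix.smul_apply, hΦ, partialTrace,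
    Matrix.of_apply, Matrix.mul_apply, Matrix.conjTranspose_apply, smul_eq_mul, Finset.mul_sum,
    Finset.sum_mul]
  rw [Finset.sum_comm]
  simp_rw [Finset.sum_comm (s := Finset.univ (α := ι)) (t := Finset.univ (α := ζ))]
  refine Finset.sum_congr rfl fun z _ => Finset.sum_congr rfl fun b _ =>
    Finset.sum_congr rfl fun a _ => by ring

/-- The trace-norm-balanced factorization is reshaped into a pair; multiplying by `R` and `S`
cancels the inverses, and reshaping preserves Frobenius norms. The equivalence `e` allows `ζ` to be
a `Fin` type. -/
theorem exists_isStinespringPair_of_isUnit [Fintype κ] [DecidableEq ι] [DecidableEq κ]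
    (Φ : SuperOp ι κ) {R S : Matrix ι ι ℂ} (hR : IsUnit R.det) (hS : IsUnit S.det) (e : ζ ≃ κ × ι) :
    ∃ A B : Matrix (κ × ζ) ι ℂ, IsStinespringPair Φ A B ∧
      frobSq (A * R) = traceNorm (tensorId ι Φ (vecOuter R S)) ∧
      frobSq (B * S) = traceNorm (tensorId ι Φ (vecOuter R S)) := by
  obtain ⟨V, W, h, hV, hW⟩ := exists_mul_conjTranspose_eq (tensorId ι Φ (vecOuter R S))
  have h' : tensorId ι Φ (vecOuter R S) = V.submatrix id e * (W.submatrix id e)ᴴ := by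
    rw [Matrix.conjTranspose_submatrix, Matrix.submatrix_mul_equiv, h, Matrix.submatrix_id_id]
  have key : ∀ V : Matrix (κ × ι) (κ × ι) ℂ,
      frobSq (Matrix.of fun (p : κ × ζ) a => V.submatrix id e (p.1, a) p.2) = frobSq V := by
    intro V
    simp only [frobSq, Fintype.sum_prod_type (α₁ := κ), Matrix.of_apply, Matrix.submatrix_apply, id]
    refine Finset.sum_congr rfl fun p _ => ?_
    rw [Finset.sum_comm]
    refine Finset.sum_congr rfl fun a _ => ?_
    rw [Equiv.sum_comp e (fun z => ‖V (p, a) z‖ ^ 2), Fintype.sum_prod_type]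
  refine ⟨_, _, isStinespringPair_of_factorization Φ hR hS _ _ h', ?_, ?_⟩
  · rw [Matrix.mul_assoc, Matrix.nonsing_inv_mul R hR, Matrix.mul_one, key, hV]
  · rw [Matrix.mul_assoc, Matrix.nonsing_inv_mul S hS, Matrix.mul_one, key, hW]

end Stinespring

/-! ### Convexity of the set of Gram pairs. -/

section Gram

open scoped Matrix

variable {ι κ : Type*}

/-- The pairs `(A* A, B* B)`, for the Stinespring pairs `(A, B)` of `Φ`. -/
def stinespringGrams [Fintype ι] [Fintype κ] (Φ : SuperOp ι κ) :
    Set (Matrix ι ι ℂ × Matrix ι ι ℂ) :=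
  {P | ∃ r : ℕ, 1 ≤ r ∧ ∃ A B : Matrix (κ × Fin r) ι ℂ,
    IsStinespringPair Φ A B ∧ P = (Aᴴ * A, Bᴴ * B)}

/-- The direct sum of `c A` and `d A'`. -/
def weightedSum {r r' : ℕ} (c d : ℝ) (A : Matrix (κ × Fin r) ι ℂ)
    (A' : Matrix (κ × Fin r') ι ℂ) : Matrix (κ × Fin (r + r')) ι ℂ :=
  Matrix.of fun p i =>
    Fin.addCases (fun z => (c : ℂ) * A (p.1, z) i) (fun z => (d : ℂ) * A' (p.1, z) i) p.2

theorem conjTranspose_weightedSum_mul_self [Fintype κ] {r r' : ℕ} (c d : ℝ)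
    (A : Matrix (κ × Fin r) ι ℂ) (A' : Matrix (κ × Fin r') ι ℂ) :
    (weightedSum c d A A')ᴴ * weightedSum c d A A' =
      (c * c) • (Aᴴ * A) + (d * d) • (A'ᴴ * A') := by
  ext i j
  simp only [weightedSum, Matrix.mul_apply, Matrix.conjTranspose_apply, Matrix.of_apply,
    Fintype.sum_prod_type, Fin.sum_univ_add, Fin.addCases_left, Fin.addCases_right,
    Matrix.add_apply, Matrix.smul_apply, Finset.sum_add_distrib, Finset.smul_sum,
    Complex.real_smul, Complex.star_def, map_mul, Complex.conj_ofReal, Complex.ofReal_mul]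
  congr 1 <;> exact Finset.sum_congr rfl fun p _ => Finset.sum_congr rfl fun z _ => by ring

theorem partialTrace_weightedSum [Fintype ι] {r r' : ℕ} (c d : ℝ) (A B : Matrix (κ × Fin r) ι ℂ)
    (A' B' : Matrix (κ × Fin r') ι ℂ) (X : Matrix ι ι ℂ) :
    partialTrace (weightedSum c d A A' * X * (weightedSum c d B B')ᴴ) =
      (c * c) • partialTrace (A * X * Bᴴ) + (d * d) • partialTrace (A' * X * B'ᴴ) := by
  ext p q
  simp only [partialTrace, weightedSum, Matrix.mul_apply, Matrix.conjTranspose_apply,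
    Matrix.of_apply, Fin.sum_univ_add, Fin.addCases_left, Fin.addCases_right,
    Matrix.add_apply, Matrix.smul_apply, Finset.smul_sum, Finset.sum_mul,
    Complex.real_smul, Complex.star_def, map_mul, Complex.conj_ofReal, Complex.ofReal_mul]
  congr 1 <;> exact Finset.sum_congr rfl fun p _ => Finset.sum_congr rfl fun z _ =>
    Finset.sum_congr rfl fun z _ => by ring

/-- Direct sums over the auxiliary space, with weights `√s` and `√t`, have no cross terms, either in
the partial trace or in the Gram matrices. -/
theorem convex_stinespringGrams [Fintype ι] [Fintype κ] (Φ : SuperOp ι κ) :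
    Convex ℝ (stinespringGrams Φ) := by
  rintro _ ⟨r, hr, A, B, h, rfl⟩ _ ⟨r', hr', A', B', h', rfl⟩ s t hs ht hst
  refine ⟨r + r', by omega, weightedSum √s √t A A', weightedSum √s √t B B', ?_, ?_⟩
  · intro X
    rw [partialTrace_weightedSum, ← h, ← h', Real.mul_self_sqrt hs, Real.mul_self_sqrt ht,
      ← add_smul, hst, one_smul]
  · rw [conjTranspose_weightedSum_mul_self, conjTranspose_weightedSum_mul_self,
      Real.mul_self_sqrt hs, Real.mul_self_sqrt ht]
    rfl

end Gram

/-! ### Linear functionals and their positive majorants. -/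

section Duality

open scoped Matrix MatrixOrder ComplexOrder Matrix.Norms.L2Operator

variable {ι κ : Type*} [Fintype ι] [Fintype κ]

/-- Every real linear functional on complex matrices is of the form `X ↦ Re Tr (G X)`. -/
theorem exists_eq_re_trace_mul [DecidableEq ι] (g : Matrix ι ι ℂ →ₗ[ℝ] ℝ) :
    ∃ G : Matrix ι ι ℂ, ∀ X, g X = (Matrix.trace (G * X)).re := by
  refine ⟨Matrix.of fun j i => ⟨g (Matrix.single i j 1), -g (Matrix.single i j Complex.I)⟩,
    fun X => ?_⟩
  have h : ∀ i j, g (Matrix.single i j (X i j)) =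
      (X i j).re * g (Matrix.single i j 1) + (X i j).im * g (Matrix.single i j Complex.I) := by
    intro i j
    have : Matrix.single i j (X i j) = (X i j).re • Matrix.single i j (1 : ℂ) +
        (X i j).im • Matrix.single i j Complex.I := by
      rw [Matrix.smul_single, Matrix.smul_single, ← Matrix.single_add]
      congr 1
      apply Complex.ext <;> simp
    rw [this, map_add, map_smul, map_smul, smul_eq_mul, smul_eq_mul]
  nth_rewrite 1 [Matrix.matrix_eq_sum_single X]
  simp only [map_sum, h, Matrix.trace, Matrix.diag, Matrix.mul_apply, Matrix.of_apply,
    Complex.re_sum, Complex.mul_re]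
  rw [Finset.sum_comm]
  exact Finset.sum_congr rfl fun i _ => Finset.sum_congr rfl fun j _ => by ring

theorem frobSq_mul_eq_re_trace {ζ : Type*} [Fintype ζ] (A : Matrix κ ι ℂ) (R : Matrix ι ζ ℂ) :
    frobSq (A * R) = (Matrix.trace (Aᴴ * A * (R * Rᴴ))).re := by
  rw [← Complex.ofReal_re (frobSq (A * R)), ← trace_conjTranspose_mul_self,
    Matrix.conjTranspose_mul, ← Matrix.mul_assoc (Aᴴ * A), Matrix.trace_mul_comm _ Rᴴ]
  simp only [Matrix.mul_assoc]

/-- The functional `X ↦ Re Tr (G X)` is dominated on positive semidefinite matrices by an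
invertible positive one, at an arbitrarily small cost. -/
theorem exists_isUnit_re_trace_mul_le [DecidableEq ι] (G : Matrix ι ι ℂ) {δ : ℝ} (hδ : 0 < δ) :
    ∃ R : Matrix ι ι ℂ, IsUnit R.det ∧ frobSq R ≤ traceNorm G + δ ∧
      ∀ H : Matrix ι ι ℂ, H.PosSemidef →
        (Matrix.trace (G * H)).re ≤ (Matrix.trace (H * (R * Rᴴ))).re := by
  obtain ⟨V, W, hG, hV, hW⟩ := exists_mul_conjTranspose_eq G
  set d : ℝ := δ / (Fintype.card ι + 1) with hd
  have hd0 : 0 < d := by positivity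
  -- The average of `V * Vᴴ` and `W * Wᴴ` dominates `G = V * Wᴴ` by the AM–GM inequality; the
  -- multiple of the identity makes it invertible and adds at most `δ` to the trace.
  set ρ : Matrix ι ι ℂ :=
    (1 / 2 : ℝ) • (V * Vᴴ + W * Wᴴ) + d • (1 : Matrix ι ι ℂ) with hρ
  have hpd : ρ.PosDef := by
    refine Matrix.PosDef.posSemidef_add ?_ (Matrix.PosDef.one.smul hd0)
    exact ((Matrix.posSemidef_self_mul_conjTranspose V).add
      (Matrix.posSemidef_self_mul_conjTranspose W)).smul (by norm_num)
  obtain ⟨R, hR⟩ : ∃ R : Matrix ι ι ℂ, ρ = R * Rᴴ := by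
    obtain ⟨B, hB⟩ := CStarAlgebra.nonneg_iff_eq_star_mul_self.1 hpd.posSemidef.nonneg
    exact ⟨Bᴴ, by rw [hB, Matrix.conjTranspose_conjTranspose]; rfl⟩
  have hfrob : ∀ A : Matrix ι ι ℂ, frobSq (A * R) =
      1 / 2 * (frobSq (A * V) + frobSq (A * W)) + d * frobSq A := by
    intro A
    have h1 : frobSq A = (Matrix.trace (Aᴴ * A)).re := by
      rw [trace_conjTranspose_mul_self, Complex.ofReal_re]
    rw [frobSq_mul_eq_re_trace, ← hR, hρ, frobSq_mul_eq_re_trace, frobSq_mul_eq_re_trace, h1]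
    simp only [Matrix.mul_add, Matrix.mul_smul, Matrix.trace_add, Matrix.trace_smul,
      Complex.add_re, Complex.smul_re, Matrix.mul_one, smul_eq_mul]
  refine ⟨R, ?_, ?_, ?_⟩
  · have := hpd.det_pos.ne'
    rw [hR, Matrix.det_mul] at this
    exact isUnit_iff_ne_zero.2 (left_ne_zero_of_mul this)
  · have := hfrob (1 : Matrix ι ι ℂ)
    have h1 : frobSq (1 : Matrix ι ι ℂ) = Fintype.card ι := by
      rw [← Complex.ofReal_re (frobSq _), ← trace_conjTranspose_mul_self]
      simp
    have h2 : d * Fintype.card ι ≤ δ := by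
      rw [hd, div_mul_eq_mul_div, div_le_iff₀ (by positivity)]
      nlinarith
    rw [Matrix.one_mul, Matrix.one_mul, Matrix.one_mul, hV, hW, h1] at this
    linarith
  · intro H hH
    obtain ⟨A, rfl⟩ : ∃ A : Matrix ι ι ℂ, H = Aᴴ * A :=
      CStarAlgebra.nonneg_iff_eq_star_mul_self.1 hH.nonneg
    have h1 : Matrix.trace (G * (Aᴴ * A)) = Matrix.trace ((A * V) * (A * W)ᴴ) := by
      rw [← hG, Matrix.conjTranspose_mul, Matrix.mul_assoc A, Matrix.trace_mul_comm A]
      simp only [Matrix.mul_assoc]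
    rw [h1, ← frobSq_mul_eq_re_trace, hfrob]
    refine (Complex.re_le_norm _).trans ((norm_trace_mul_conjTranspose_le _ _).trans ?_)
    have := two_mul_le_add_sq √(frobSq (A * V)) √(frobSq (A * W))
    rw [Real.sq_sqrt (frobSq_nonneg _), Real.sq_sqrt (frobSq_nonneg _)] at this
    have := mul_nonneg hd0.le (frobSq_nonneg A)
    linarith

end Duality

/-! ### Hahn–Banach argument. -/

section Separation

open scoped Matrix ComplexOrder Matrix.Norms.L2Operator

variable {ι κ : Type*} [Fintype ι] [DecidableEq ι] [Fintype κ]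

theorem exists_norm_le_one_re_trace_mul_eq (G : Matrix ι ι ℂ) :
    ∃ U : Matrix ι ι ℂ, ‖U‖ ≤ 1 ∧ (Matrix.trace (G * U)).re = traceNorm G := by
  obtain ⟨U, hU, h⟩ := exists_trace_eq_traceNorm G
  refine ⟨Uᴴ, ?_, by rw [Matrix.trace_mul_comm, h]⟩
  rw [Matrix.l2_opNorm_conjTranspose]
  exact hU

/-- If weighted Frobenius norms of Stinespring pairs can be bounded by `C`, for each choice of the
weights, then so can their operator norms. -/
theorem exists_isStinespringPair_opNorm_sq_lt {Φ : SuperOp ι κ} {C ε : ℝ} (hC : 0 ≤ C)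
    (hε : 0 < ε)
    (h : ∀ R S : Matrix ι ι ℂ, IsUnit R.det → IsUnit S.det →
      ∃ r : ℕ, 1 ≤ r ∧ ∃ A B : Matrix (κ × Fin r) ι ℂ, IsStinespringPair Φ A B ∧
        frobSq (A * R) + frobSq (B * S) ≤ C * (frobSq R + frobSq S)) :
    ∃ r : ℕ, 1 ≤ r ∧ ∃ A B : Matrix (κ × Fin r) ι ℂ, IsStinespringPair Φ A B ∧
      opNorm A ^ 2 < C + ε ∧ opNorm B ^ 2 < C + ε := by
  -- The product carries the maximum norm, so a Gram pair in this ball bounds both squared norms.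
  by_cases hdisj : Disjoint (Metric.ball (0 : Matrix ι ι ℂ × Matrix ι ι ℂ) (C + ε))
      (stinespringGrams Φ)
  swap
  · obtain ⟨P, hP, r, hr, A, B, hAB, rfl⟩ := Set.not_disjoint_iff.1 hdisj
    rw [mem_ball_zero_iff, Prod.norm_def, max_lt_iff, Matrix.l2_opNorm_conjTranspose_mul_self,
      Matrix.l2_opNorm_conjTranspose_mul_self, ← pow_two, ← pow_two] at hP
    exact ⟨r, hr, A, B, hAB, hP⟩
  exfalso
  obtain ⟨f, u, hball, hgram⟩ := geometric_hahn_banach_open (convex_ball _ _) Metric.isOpen_ball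
    (convex_stinespringGrams Φ) hdisj
  obtain ⟨G, hG⟩ := exists_eq_re_trace_mul (f.toLinearMap ∘ₗ LinearMap.inl ℝ _ _)
  obtain ⟨K, hK⟩ := exists_eq_re_trace_mul (f.toLinearMap ∘ₗ LinearMap.inr ℝ _ _)
  have hf : ∀ X Y, f (X, Y) = (Matrix.trace (G * X)).re + (Matrix.trace (K * Y)).re := by
    intro X Y
    rw [← hG, ← hK]
    change _ = f (X, 0) + f (0, Y)
    rw [← map_add]
    simp
  set t := traceNorm G + traceNorm K with ht
  have ht0 : 0 ≤ t := add_nonneg (traceNorm_nonneg G) (traceNorm_nonneg K)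
  -- Strictness also covers `t = 0`, where the two bounds would give `0 < u ≤ 0`.
  have hlow : (C + ε / 2) * t < u := by
    obtain ⟨U, hU, hGU⟩ := exists_norm_le_one_re_trace_mul_eq G
    obtain ⟨U', hU', hKU⟩ := exists_norm_le_one_re_trace_mul_eq K
    have hs : 0 ≤ C + ε / 2 := by positivity
    have hnorm : ∀ U : Matrix ι ι ℂ, ‖U‖ ≤ 1 → ‖(C + ε / 2) • U‖ < C + ε := by
      intro U hU
      rw [norm_smul, Real.norm_of_nonneg hs]
      nlinarith
    have := hball ((C + ε / 2) • U, (C + ε / 2) • U') (by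
      rw [mem_ball_zero_iff, Prod.norm_def, max_lt_iff]
      exact ⟨hnorm U hU, hnorm U' hU'⟩)
    rw [hf, Matrix.mul_smul, Matrix.mul_smul, Matrix.trace_smul, Matrix.trace_smul,
      Complex.smul_re, Complex.smul_re, hGU, hKU, smul_eq_mul, smul_eq_mul, ← mul_add] at this
    exact this
  have hup : ∀ δ > 0, u ≤ C * t + δ := by
    intro δ hδ
    have hδ' : 0 < δ / (2 * (C + 1)) := by positivity
    obtain ⟨R, hR, hR1, hR2⟩ := exists_isUnit_re_trace_mul_le G hδ'
    obtain ⟨S, hS, hS1, hS2⟩ := exists_isUnit_re_trace_mul_le K hδ'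
    obtain ⟨r, hr, A, B, hAB, hle⟩ := h R S hR hS
    have h1 := hgram _ ⟨r, hr, A, B, hAB, rfl⟩
    rw [hf] at h1
    have h2 : C * (frobSq R + frobSq S) ≤ C * (t + δ / (C + 1)) := by
      refine mul_le_mul_of_nonneg_left ?_ hC
      have : δ / (C + 1) = δ / (2 * (C + 1)) + δ / (2 * (C + 1)) := by
        field_simp
        ring
      linarith
    have h3 : C * (δ / (C + 1)) ≤ δ := by
      rw [mul_div_assoc', div_le_iff₀ (by positivity)]
      nlinarith
    have h4 := hR2 _ (Matrix.posSemidef_conjTranspose_mul_self A)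
    have h5 := hS2 _ (Matrix.posSemidef_conjTranspose_mul_self B)
    rw [← frobSq_mul_eq_re_trace] at h4 h5
    linarith
  have hle : u ≤ C * t := le_of_forall_pos_le_add hup
  nlinarith

end Separation

/-! ### Induced norms and their bounds. -/

section CompletelyBounded

variable {ι κ τ : Type*} [Fintype ι] [DecidableEq ι] [Fintype κ] [DecidableEq κ]

theorem traceNorm_le_inducedTraceNorm_mul {Φ : SuperOp ι κ} (hΦ : BddAbove (traceNormValues Φ))
    (X : Matrix ι ι ℂ) {c : ℝ} (hX : traceNorm X ≤ c) :
    traceNorm (Φ X) ≤ inducedTraceNorm Φ * c := by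
  have key : ∀ d : ℝ, 0 < d → traceNorm X ≤ d → traceNorm (Φ X) ≤ inducedTraceNorm Φ * d := by
    intro d hd hX
    have h1 : traceNorm (((d⁻¹ : ℝ) : ℂ) • X) ≤ 1 := by
      refine (traceNorm_smul_le _ _).trans ?_
      rw [Complex.norm_real, Real.norm_of_nonneg (by positivity), inv_mul_le_iff₀ hd, mul_one]
      exact hX
    have h2 : traceNorm (Φ (((d⁻¹ : ℝ) : ℂ) • X)) ≤ inducedTraceNorm Φ :=
      le_csSup hΦ ⟨_, h1, rfl⟩
    have h3 : Φ X = (d : ℂ) • Φ (((d⁻¹ : ℝ) : ℂ) • X) := by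
      rw [map_smul, smul_smul, ← Complex.ofReal_mul, mul_inv_cancel₀ hd.ne', Complex.ofReal_one,
        one_smul]
    rw [h3]
    refine (traceNorm_smul_le _ _).trans ?_
    rw [Complex.norm_real, Real.norm_of_nonneg hd.le, mul_comm]
    exact mul_le_mul_of_nonneg_right h2 hd.le
  have hc : 0 ≤ c := (traceNorm_nonneg X).trans hX
  rcases hc.eq_or_lt with rfl | hc
  · have h0 : 0 ≤ inducedTraceNorm Φ :=
      (traceNorm_nonneg _).trans ((key 1 one_pos (hX.trans zero_le_one)).trans_eq (mul_one _))
    rw [mul_zero]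
    -- For `c = 0`, letting `d` tend to `0` avoids proving that the trace norm is definite.
    refine le_of_forall_pos_le_add fun δ hδ => ?_
    have hpos : 0 < inducedTraceNorm Φ + 1 := by positivity
    refine (key (δ / (inducedTraceNorm Φ + 1)) (by positivity) (hX.trans (by positivity))).trans ?_
    rw [zero_add, mul_div_assoc', div_le_iff₀ hpos]
    nlinarith
  · exact key c hc hX

theorem traceNorm_zero : traceNorm (0 : Matrix κ ι ℂ) = 0 := by
  refine le_antisymm ?_ (traceNorm_nonneg _)
  simpa using traceNorm_smul_le 0 (0 : Matrix κ ι ℂ)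

theorem traceNormValues_nonempty (Φ : SuperOp ι κ) : (traceNormValues Φ).Nonempty :=
  ⟨_, 0, by simp [traceNorm_zero], rfl⟩

theorem IsStinespringPair.mem_upperBounds_traceNormValues {ζ : Type*} [Fintype ζ] [Fintype τ]
    [DecidableEq τ] {Φ : SuperOp ι κ} {A B : Matrix (κ × ζ) ι ℂ} (h : IsStinespringPair Φ A B) :
    opNorm A * opNorm B ∈ upperBounds (traceNormValues (tensorId τ Φ)) := by
  rintro _ ⟨X, hX, rfl⟩
  exact (h.traceNorm_tensorId_le X).trans
    (mul_le_of_le_one_right (mul_nonneg (opNorm_nonneg A) (opNorm_nonneg B)) hX)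

theorem IsStinespringPair.mem_upperBounds_ampliationNorms {ζ : Type*} [Fintype ζ]
    {Φ : SuperOp ι κ} {A B : Matrix (κ × ζ) ι ℂ} (h : IsStinespringPair Φ A B) :
    opNorm A * opNorm B ∈ upperBounds (ampliationNorms Φ) := by
  rintro _ ⟨k, -, rfl⟩
  exact csSup_le (traceNormValues_nonempty _) h.mem_upperBounds_traceNormValues

end CompletelyBounded

end CBNorm

/-! ### The main theorem. -/

theorem mainTheorem4 (n m : ℕ) (hn : 1 ≤ n) (hm : 1 ≤ m)
    (Φ : CBNorm.SuperOp (Fin n) (Fin m)) :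
    (∀ k : ℕ, 1 ≤ k → BddAbove (CBNorm.traceNormValues (CBNorm.tensorId (Fin k) Φ))) ∧
      BddAbove (CBNorm.ampliationNorms Φ) ∧
      (CBNorm.stinespringNormProducts Φ).Nonempty ∧
      CBNorm.cbTraceNorm Φ = sInf (CBNorm.stinespringNormProducts Φ) := by
  open CBNorm in
  have hmn : 1 ≤ m * n := Nat.mul_pos hm hn
  obtain ⟨A₀, B₀, h₀, -⟩ := exists_isStinespringPair_of_isUnit Φ
    (R := 1) (S := 1) (by simp) (by simp)
    (finProdFinEquiv (m := m) (n := n)).symm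
  have hbdd : ∀ k : ℕ, BddAbove (traceNormValues (tensorId (Fin k) Φ)) := fun k =>
    ⟨_, h₀.mem_upperBounds_traceNormValues⟩
  have hamp : BddAbove (ampliationNorms Φ) := ⟨_, h₀.mem_upperBounds_ampliationNorms⟩
  have hne : (stinespringNormProducts Φ).Nonempty := ⟨_, m * n, hmn, A₀, B₀, h₀, rfl⟩
  refine ⟨fun k _ => hbdd k, hamp, hne, le_antisymm ?_ ?_⟩
  · refine le_csInf hne ?_
    rintro _ ⟨r, -, A, B, h, rfl⟩
    exact csSup_le ⟨_, 1, le_rfl, rfl⟩ h.mem_upperBounds_ampliationNorms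
  -- Only `k = n` is needed here, since `vec(R)` lives in `ℂ^n ⊗ ℂ^n`.
  have hle : inducedTraceNorm (tensorId (Fin n) Φ) ≤ cbTraceNorm Φ := le_csSup hamp ⟨n, hn, rfl⟩
  have hC : 0 ≤ cbTraceNorm Φ := by
    refine le_trans ?_ hle
    exact (traceNorm_nonneg _).trans
      (le_csSup (hbdd n) ⟨0, by simp [traceNorm_zero], rfl⟩)
  refine le_of_forall_pos_le_add fun ε hε => ?_
  obtain ⟨r, hr, A, B, hAB, hA, hB⟩ := exists_isStinespringPair_opNorm_sq_lt hC hε (Φ := Φ) (by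
    intro R S hR hS
    obtain ⟨A, B, hAB, hA, hB⟩ := exists_isStinespringPair_of_isUnit Φ hR hS
      (finProdFinEquiv (m := m) (n := n)).symm
    refine ⟨m * n, hmn, A, B, hAB, ?_⟩
    have h1 := traceNorm_le_inducedTraceNorm_mul (hbdd n) _ (traceNorm_vecOuter_le R S)
    have h2 := two_mul_le_add_sq √(frobSq R) √(frobSq S)
    rw [Real.sq_sqrt (frobSq_nonneg _), Real.sq_sqrt (frobSq_nonneg _)] at h2
    have h3 := mul_le_mul_of_nonneg_right hle
      (mul_nonneg (Real.sqrt_nonneg (frobSq R)) (Real.sqrt_nonneg (frobSq S)))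
    have h4 := mul_le_mul_of_nonneg_left h2 hC
    rw [hA, hB]
    linarith)
  have hmem : opNorm A * opNorm B ∈ stinespringNormProducts Φ := ⟨r, hr, A, B, hAB, rfl⟩
  refine (csInf_le ⟨0, ?_⟩ hmem).trans ?_
  · rintro _ ⟨r, -, A, B, -, rfl⟩
    exact mul_nonneg (opNorm_nonneg A) (opNorm_nonneg B)
  -- The product is at most the mean of the squares, each below `C + ε`, with `C` the diamond norm.
  · have := two_mul_le_add_sq (opNorm A) (opNorm B)
    linarith
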